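/- **Setting.** Let $\mathcal S$ (states) and $\mathcal A$ (actions) be separable metric spaces with Borel reference measures $\mathrm ds$ ($\sigma$-finite) and $\mathrm da$. Each state $s$ has a measurable set $\mathcal A(s)\subseteq\mathcal A$ of available actions, and $T(s,a)\in\mathcal S$ is the state reached by $a\in\mathcal A(s)$. Write $s\to s'$ if $s'=T(s,a)$ for some $a\in\mathcal A(s)$; $\mathcal P(s')=\{s: s\to s'\}$, $\mathcal C(s)=\{s': s\to s'\}$; the set of pairs with $s\to s'$ is measurable. A trajectory is a finite sequence $(s_1,\dots,s_m)$ with $s_t\to s_{t+1}$; $s<s'$ means that a trajectory with at least one transition leads from $s$ to $s'$. There are distinct states $s_0,s_f$; complete trajectories are those from $s_0$ to $s_f$. Assume: 1. every trajectory is acyclic (its states are pairwise distinct), complete trajectories have bounded length, $s_0<s$ for all $s\ne s_0$, and $s<s_f$ for all $s\neq s_f$; 2. for $s\to s'$ the action $a\in\mathcal A(s)$ with $T(s,a)=s'$ is unique and depends continuously on $(s,s')$, and $a\mapsto T(s,a)$ carries $\mathrm da$ on $\mathcal A(s)$ to $\mathrm ds$ on $\mathcal C(s)$ (no Jacobian,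 as for translations $T(s,a)=s+a$); 3. $\{s_0\}$ and $\{s_f\}$ have $\mathrm ds$-mass $1$, and every relative neighbourhood of a point of $\mathcal A(s)$ in $\mathcal A(s)$, or of a point of $\mathcal P(s')$ in $\mathcal P(s')$, has positive measure. On finite sequences of states let $\mathrm d\tau$ be the product measure $\mathrm ds\otimes\cdots\otimes\mathrm ds$ on each length, summed over all lengths. A *flow* is a non-negative measurable function $F$ on complete trajectories, extended by $0$ to all other sequences. Its state flow $F(s)$, edge flow $F(s\to s')$ and prefix flow $F(p)$ are the integrals of $F(\tau)$ over the complete trajectories that pass through $s$, pass through $s\to s'$, or begin with $p$, respectively (integration being over the remaining states). $F$ is *Markovian* if for every trajectory $p$ from $s_0$ to $s$ with $0<F(p)<\infty$ and every $s\to s'$, $F(p,s')/F(p)=F(s\to s')/F(s)$ (with $0/0=0$). **Theorem.** Let $\hat F$ be a non-negative function, given on states as $\hat F(s)$ and on state–action pairs as $\hat F(s,a)$, where $\hat F(s,a)$ is Lipschitz in $a$ and in $s$ with a common constant. Put $\hat F(s\to s')=\hat F(s,a)$ for the action $a:s\to s'$. Then $\hat F$ corresponds to a flow, i.e. there is a flow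 $F$ with $F(s)=\hat F(s)$ for all $s$ and $F(s\to s')=\hat F(s\to s')$ for all $s\to s'$, if and only if $$\forall s'>s_0:\ \hat F(s')=\int_{\mathcal P(s')}\hat F(s\to s')\,\mathrm ds,\qquad \forall s'<s_f:\ \hat F(s')=\int_{\mathcal C(s')}\hat F(s'\to s'')\,\mathrm ds''=\int_{\mathcal A(s')}\hat F(s',a)\,\mathrm da .$$ In that case there is a Markovian flow $F$ matching $\hat F$ on all states and transitions, with $$F(\tau)=\frac{\prod_{t=1}^{n+1}\hat F(s_{t-1}\to s_t)}{\prod_{t=1}^{n}\hat F(s_t)}\quad\text{for every complete trajectory }\tau=(s_0,s_1,\dots,s_n,s_{n+1}=s_f)$$ (a quotient with denominator $0$ being read as $0$), and it is unique: every Markovian flow matching $\hat F$ equals $F$ for $\mathrm d\tau$-almost every $\tau$. -/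

import Mathlib

open MeasureTheory Topology
open scoped ENNReal NNReal

/-- The data of a continuous task: for every state `s` a set `acts s` of available actions, the
transition function `T`, the initial state `s₀`, the final state `sf`, and the reference measures
`ds` on states and `da` on actions. Values `T s a` with `a ∉ acts s` carry no meaning. -/
structure FlowTask (S A : Type*) [MeasurableSpace S] [MeasurableSpace A] where
  acts : S → Set A
  T : S → A → S
  s₀ : S
  sf : S
  ds : Measure S
  da : Measure A

namespace FlowTask

variable {S A : Type*} [MeasurableSpace S] [MeasurableSpace A]

/-- `s → s'` is a transition. -/
def Edge (M : FlowTask S A) (s s' : S) : Prop := ∃ a ∈ M.acts s, M.T s a = s'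

/-- The parent set. -/
def parents (M : FlowTask S A) (s' : S) : Set S := {s | M.Edge s s'}

/-- The child set. -/
def children (M : FlowTask S A) (s : S) : Set S := {s' | M.Edge s s'}

/-- `s < s'`: some trajectory leads from `s` to `s'`. -/
def Before (M : FlowTask S A) : S → S → Prop := Relation.TransGen M.Edge

/-- The action `a : s → s'`, meaningful if `s → s'` is a transition. -/
noncomputable def action [Nonempty A] (M : FlowTask S A) (s s' : S) : A :=
  Function.invFunOn (M.T s) (M.acts s) s'

/-- A trajectory is a finite sequence of states joined by transitions. -/
def IsTrajectory (M : FlowTask S A) (τ : List S) : Prop := τ.IsChain M.Edge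

/-- A trajectory that starts in the initial state. -/
def IsInitial (M : FlowTask S A) (τ : List S) : Prop :=
  M.IsTrajectory τ ∧ τ.head? = some M.s₀

/-- A complete trajectory leads from the initial state to the final state. -/
def IsComplete (M : FlowTask S A) (τ : List S) : Prop :=
  M.IsTrajectory τ ∧ τ.head? = some M.s₀ ∧ τ.getLast? = some M.sf

/-- The assumptions on a continuous acyclic task. -/
structure IsAcyclicTask [MetricSpace S] [MetricSpace A] [Nonempty A] (M : FlowTask S A) : Prop where
  sigmaFinite : SigmaFinite M.ds
  measurableSet_acts : ∀ s, MeasurableSet (M.acts s)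
  measurableSet_edges : MeasurableSet {e : S × S | M.Edge e.1 e.2}
  /-- Every trajectory is acyclic. -/
  acyclic : ∀ τ, M.IsTrajectory τ → τ.Nodup
  /-- The length of complete trajectories is bounded. -/
  horizon : ∃ N : ℕ, ∀ τ, M.IsComplete τ → τ.length ≤ N
  s₀_ne_sf : M.s₀ ≠ M.sf
  /-- The task is pointed: `s₀` comes before all other states, `sf` after all other states. -/
  s₀_before : ∀ s, s ≠ M.s₀ → M.Before M.s₀ s
  before_sf : ∀ s, s ≠ M.sf → M.Before s M.sf
  /-- The two distinguished states have unit mass, so that integrals over parents and children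
  see the transitions out of `s₀` and into `sf`. -/
  ds_s₀ : M.ds {M.s₀} = 1
  ds_sf : M.ds {M.sf} = 1
  /-- At most one action leads from a state to another one. -/
  unique_action : ∀ s, Set.InjOn (M.T s) (M.acts s)
  /-- Actions are translations: passing from actions to children costs no Jacobian, and the action
  depends continuously on the two states it joins (for `T s a = s + a`, it is `s' - s`). -/
  translation : ∀ s, MeasurePreserving (M.T s)
    (M.da.restrict (M.acts s)) (M.ds.restrict (M.children s))
  continuousOn_action : ContinuousOn (fun e : S × S ↦ M.action e.1 e.2) {e | M.Edge e.1 e.2}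
  /-- The reference measures have full support on the sets of available actions and of parents. -/
  da_pos : ∀ s, ∀ a ∈ M.acts s, ∀ U ∈ 𝓝 a, 0 < M.da (U ∩ M.acts s)
  ds_pos : ∀ s', ∀ s ∈ M.parents s', ∀ U ∈ 𝓝 s, 0 < M.ds (U ∩ M.parents s')

/-- The integral `∫ f(τ) dτ` over finite sequences of states, of all lengths, with respect to the
product measures `ds ⊗ ⋯ ⊗ ds`. -/
noncomputable def seqIntegral (M : FlowTask S A) (f : List S → ℝ≥0∞) : ℝ≥0∞ :=
  ∑' n : ℕ, ∫⁻ x : Fin n → S, f (List.ofFn x) ∂(Measure.pi fun _ ↦ M.ds)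

/-- A trajectory flow: a nonnegative measurable function on the set of complete trajectories,
extended by zero to all sequences of states. -/
structure TrajectoryFlow (M : FlowTask S A) where
  toFun : List S → ℝ≥0
  measurable_toFun : ∀ n : ℕ, Measurable fun x : Fin n → S ↦ toFun (List.ofFn x)
  eq_zero : ∀ τ, ¬ M.IsComplete τ → toFun τ = 0

namespace TrajectoryFlow

variable {M : FlowTask S A}

/-- `F(s)`: the integral of `F(τ)` over the complete trajectories through `s`; the integration is
over the part `p` of `τ` before `s` and the part `q` after it. -/
noncomputable def stateFlow (F : M.TrajectoryFlow) (s : S) : ℝ≥0∞ :=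
  M.seqIntegral fun p ↦ M.seqIntegral fun q ↦ (F.toFun (p ++ s :: q) : ℝ≥0∞)

/-- `F(s → s')`: the integral of `F(τ)` over the complete trajectories through `s → s'`. -/
noncomputable def edgeFlow (F : M.TrajectoryFlow) (s s' : S) : ℝ≥0∞ :=
  M.seqIntegral fun p ↦ M.seqIntegral fun q ↦ (F.toFun (p ++ s :: s' :: q) : ℝ≥0∞)

/-- The integral of `F(τ)` over the complete trajectories that begin with `p`. -/
noncomputable def prefixFlow (F : M.TrajectoryFlow) (p : List S) : ℝ≥0∞ :=
  M.seqIntegral fun q ↦ (F.toFun (p ++ q) : ℝ≥0∞)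

/-- Markovian flow: `P(s → s' | τ) = P(s → s' | s) = F(s → s') / F(s)` for every trajectory `τ`
from `s₀` to `s`, the left side being defined when the flow that begins with `τ` is positive
and finite. -/
def IsMarkovian (F : M.TrajectoryFlow) : Prop :=
  ∀ (p : List S) (s s' : S), M.IsInitial (p ++ [s]) → M.Edge s s' →
    F.prefixFlow (p ++ [s]) ≠ 0 → F.prefixFlow (p ++ [s]) ≠ ∞ →
      F.prefixFlow (p ++ [s, s']) / F.prefixFlow (p ++ [s]) = F.edgeFlow s s' / F.stateFlow s

end TrajectoryFlow

/-- `F̂(s → s')`, the value of `F̂(s, a)` at the action `a : s → s'`. -/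
noncomputable def onEdge [Nonempty A] (M : FlowTask S A) (Fa : S → A → ℝ≥0) (s s' : S) : ℝ≥0 :=
  Fa s (M.action s s')

/-- The flow `F` matches `F̂`, given by `Fs` on states and by `Fa` on state-action pairs. -/
def Matches [Nonempty A] (M : FlowTask S A) (Fs : S → ℝ≥0) (Fa : S → A → ℝ≥0)
    (F : M.TrajectoryFlow) : Prop :=
  (∀ s, F.stateFlow s = Fs s) ∧ ∀ s s', M.Edge s s' → F.edgeFlow s s' = M.onEdge Fa s s'

/-- The continuous flow matching conditions. -/
def FlowMatching [Nonempty A] (M : FlowTask S A) (Fs : S → ℝ≥0) (Fa : S → A → ℝ≥0) : Prop :=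
  (∀ s', M.Before M.s₀ s' →
    (Fs s' : ℝ≥0∞) = ∫⁻ s in M.parents s', (M.onEdge Fa s s' : ℝ≥0∞) ∂M.ds) ∧
  (∀ s', M.Before s' M.sf →
    (Fs s' : ℝ≥0∞) = ∫⁻ s'' in M.children s', (M.onEdge Fa s' s'' : ℝ≥0∞) ∂M.ds ∧
    (Fs s' : ℝ≥0∞) = ∫⁻ a in M.acts s', (Fa s' a : ℝ≥0∞) ∂M.da)

end FlowTask

/-!
Cutting the complete trajectories through a state at that state writes its flow as an integral
of prefix flows, and letting the last state before it, or the first one after it, vary gives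
the two conservation laws; hence matching is necessary.

Conversely, conservation says that the transition probabilities `F̂(s → s') / F̂(s)` integrate
to one over `s'`, provided that `F̂(s) ≠ 0`. Let `F` be the law of the corresponding random
walk, started at `s₀` with mass `F̂(s₀)` and stopped at `sf`. Induction from `sf` backwards
shows that the flow of `F` through a prefix is the product of its transition probabilities
times `F̂(s₀)`, and induction from `s₀` forwards then that `F` has state flow `F̂`. If
`F̂(s) = 0`, then `F̂` vanishes on the edges at `s`, because a continuous function with integral
zero vanishes where the measure has full support.

A Markovian flow is determined by its state and edge flows: the Markov property gives the
prefix flows one state at a time, as long as they are positive and finite, and a prefix of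
flow zero or of finite flow has almost surely only extensions of the same kind.
-/

section Relation

variable {α : Type*} {r : α → α → Prop}

theorem exists_isChain_append_of_reflTransGen {l : List α} (hl : l.IsChain r) {a b : α}
    (ha : l.getLast? = some a) (hab : Relation.ReflTransGen r a b) :
    ∃ q, (l ++ q).IsChain r ∧ (l ++ q).getLast? = some b := by
  induction hab with
  | refl => exact ⟨[], by simpa using hl, by simpa using ha⟩
  | @tail b c _ hbc ih =>
    obtain ⟨q, hq, hb⟩ := ih
    exact ⟨q ++ [c], by simpa [← List.append_assoc, List.isChain_append, hq, hb] using hbc,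
      by simp [← List.append_assoc]⟩

theorem exists_isChain_prepend_of_reflTransGen {l : List α} (hl : l.IsChain r) {a b : α}
    (hb : l.head? = some b) (hab : Relation.ReflTransGen r a b) :
    ∃ p, (p ++ l).IsChain r ∧ (p ++ l).head? = some a := by
  induction hab using Relation.ReflTransGen.head_induction_on with
  | refl => exact ⟨[], hl, hb⟩
  | @head a c hac _ ih =>
    obtain ⟨p, hp, hc⟩ := ih
    exact ⟨a :: p, by simpa [List.isChain_cons, hp, hc] using hac, rfl⟩

theorem wellFounded_of_isChain_length_le {N : ℕ} (h : ∀ l : List α, l.IsChain r → l.length ≤ N) :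
    WellFounded r := by
  rw [wellFounded_iff_isEmpty_descending_chain]
  refine ⟨fun ⟨f, hf⟩ ↦ ?_⟩
  have hchain : (List.ofFn fun i : Fin (N + 1) ↦ f i).IsChain (flip r) :=
    List.isChain_ofFn.2 fun i _ ↦ hf i
  simpa using h _ (List.isChain_reverse.2 hchain)

end Relation

section StepProd

variable {α R : Type*}

/-- The product of `K` over the consecutive pairs of a list, used for the weight of a trajectory. -/
def stepProd [Mul R] [One R] (K : α → α → R) (l : List α) : R :=
  (l.zipWith K l.tail).prod

theorem stepProd_append_pair [Monoid R] (K : α → α → R) (p : List α) (a b : α) :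
    stepProd K (p ++ [a, b]) = stepProd K (p ++ [a]) * K a b := by
  induction p with
  | nil => simp [stepProd]
  | cons c p ih =>
    cases p with
    | nil => simp [stepProd]
    | cons d p => simpa [stepProd, mul_assoc] using congrArg (K c d * ·) ih

theorem stepProd_ofFn [CommMonoid R] (K : α → α → R) {n : ℕ} (x : Fin (n + 1) → α) :
    stepProd K (List.ofFn x) = ∏ i : Fin n, K (x i.castSucc) (x i.succ) := by
  have h : List.zipWith K (List.ofFn x) (List.ofFn x).tail =
      List.ofFn fun i : Fin n ↦ K (x i.castSucc) (x i.succ) :=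
    List.ext_getElem (by simp) fun i _ _ ↦ by simp [-List.ofFn_succ]
  rw [stepProd, h, List.prod_ofFn]

theorem isChain_of_stepProd_ne_zero [MonoidWithZero R] {r : α → α → Prop} {K : α → α → R}
    (hK : ∀ a b, ¬ r a b → K a b = 0) {l : List α} (h : stepProd K l ≠ 0) : l.IsChain r := by
  induction l with
  | nil => exact .nil
  | cons a l ih =>
    cases l with
    | nil => exact .singleton a
    | cons b l =>
      have hmul : stepProd K (a :: b :: l) = K a b * stepProd K (b :: l) := by simp [stepProd]
      rw [hmul] at h
      exact (ih (right_ne_zero_of_mul h)).cons_cons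
        (not_imp_comm.1 (hK a b) (left_ne_zero_of_mul h))

end StepProd

section Measure

theorem eqOn_zero_of_setLIntegral_eq_zero {X : Type*} [TopologicalSpace X]
    [MeasurableSpace X] [OpensMeasurableSpace X] {μ : Measure X} {E : Set X} (hE : MeasurableSet E)
    {f : X → ℝ≥0∞} (hf : ContinuousOn f E) (hμ : ∀ x ∈ E, ∀ U ∈ 𝓝 x, 0 < μ (U ∩ E))
    (h : ∫⁻ x in E, f x ∂μ = 0) : Set.EqOn f 0 E := by
  intro x hx
  by_contra hne
  have hae : ∀ᵐ y ∂μ, y ∈ E → f y = 0 :=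
    (ae_restrict_iff' hE).1 ((lintegral_eq_zero_iff' (hf.aemeasurable hE)).1 h)
  obtain ⟨U, hU, hUE⟩ := mem_nhdsWithin_iff_exists_mem_nhds_inter.1
    ((hf x hx).eventually_ne hne)
  refine (hμ x hx U hU).ne' (measure_mono_null (fun y hy ↦ ?_) hae)
  exact fun h0 ↦ hUE hy (h0 hy.2)

variable {S : Type*} [MeasurableSpace S] (μ : Measure S) [SigmaFinite μ]

theorem measurePreserving_finCons (n : ℕ) :
    MeasurePreserving (fun z : S × (Fin n → S) ↦ (Fin.cons z.1 z.2 : Fin (n + 1) → S))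
      (μ.prod (Measure.pi fun _ ↦ μ)) (Measure.pi fun _ ↦ μ) := by
  simpa [MeasurableEquiv.piFinSuccAbove, Fin.insertNthEquiv] using
    (measurePreserving_piFinSuccAbove (fun _ : Fin (n + 1) ↦ μ) 0).symm

theorem measurePreserving_finSnoc (n : ℕ) :
    MeasurePreserving (fun z : (Fin n → S) × S ↦ Fin.snoc (α := fun _ ↦ S) z.1 z.2)
      ((Measure.pi fun _ ↦ μ).prod μ) (Measure.pi fun _ ↦ μ) := by
  have h := (measurePreserving_piFinSuccAbove (fun _ : Fin (n + 1) ↦ μ) (Fin.last n)).symm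
  simpa [MeasurableEquiv.piFinSuccAbove, Fin.insertNthEquiv, Function.comp_def] using
    h.comp Measure.measurePreserving_swap

theorem lintegral_pi_cons {n : ℕ} {f : (Fin (n + 1) → S) → ℝ≥0∞} (hf : Measurable f) :
    ∫⁻ x, f x ∂(Measure.pi fun _ ↦ μ) =
      ∫⁻ s, ∫⁻ y : Fin n → S, f (Fin.cons s y) ∂(Measure.pi fun _ ↦ μ) ∂μ := by
  have h := measurePreserving_finCons μ n
  rw [← h.lintegral_comp hf]
  exact lintegral_prod _ (hf.comp h.measurable).aemeasurable

theorem lintegral_pi_snoc {n : ℕ} {f : (Fin (n + 1) → S) → ℝ≥0∞} (hf : Measurable f) :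
    ∫⁻ x, f x ∂(Measure.pi fun _ ↦ μ) =
      ∫⁻ y : Fin n → S, ∫⁻ s, f (Fin.snoc (α := fun _ ↦ S) y s) ∂μ ∂(Measure.pi fun _ ↦ μ) := by
  have h := measurePreserving_finSnoc μ n
  rw [← h.lintegral_comp hf]
  exact lintegral_prod _ (hf.comp h.measurable).aemeasurable

theorem ae_pi_of_ae_ae_snoc {n : ℕ} {P : (Fin (n + 1) → S) → Prop} (hP : MeasurableSet {x | P x})
    (h : ∀ᵐ y ∂(Measure.pi fun _ : Fin n ↦ μ), ∀ᵐ s ∂μ, P (Fin.snoc (α := fun _ ↦ S) y s)) :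
    ∀ᵐ x ∂(Measure.pi fun _ : Fin (n + 1) ↦ μ), P x := by
  have hpres := measurePreserving_finSnoc μ n
  rw [← hpres.map_eq, ae_map_iff hpres.measurable.aemeasurable hP]
  exact (Measure.ae_prod_iff_ae_ae (hpres.measurable hP)).2 h

end Measure

theorem ofFn_finSnoc {α : Type*} {n : ℕ} (y : Fin n → α) (a : α) :
    List.ofFn (Fin.snoc (α := fun _ ↦ α) y a) = List.ofFn y ++ [a] := by
  simp [List.ofFn_succ', -List.ofFn_succ]

/-- A family of lists of one common length whose entries depend measurably on the parameter. It
takes the place of measurability into `List S`, which carries no `MeasurableSpace` instance. -/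
def MeasurableListMap {α S : Type*} [MeasurableSpace α] [MeasurableSpace S] (u : α → List S) :
    Prop :=
  ∃ (n : ℕ) (v : α → Fin n → S), Measurable v ∧ ∀ a, u a = List.ofFn (v a)

namespace MeasurableListMap

variable {α β S : Type*} [MeasurableSpace α] [MeasurableSpace β] [MeasurableSpace S]
  {u u' : α → List S}

theorem ofFn {n : ℕ} {v : α → Fin n → S} (hv : Measurable v) :
    MeasurableListMap fun a ↦ List.ofFn (v a) := ⟨n, v, hv, fun _ ↦ rfl⟩

theorem const (p : List S) : MeasurableListMap fun _ : α ↦ p :=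
  ⟨p.length, fun _ ↦ p.get, measurable_const, fun _ ↦ (List.ofFn_get p).symm⟩

theorem append (hu : MeasurableListMap u) (hu' : MeasurableListMap u') :
    MeasurableListMap fun a ↦ u a ++ u' a := by
  obtain ⟨n, v, hv, h⟩ := hu
  obtain ⟨n', v', hv', h'⟩ := hu'
  refine ⟨n + n', fun a ↦ Fin.append (v a) (v' a), measurable_pi_iff.2 fun i ↦ ?_, fun a ↦ by
    simp only [List.ofFn_fin_append, h, h']⟩
  cases i using Fin.addCases with
  | left i => simpa using measurable_pi_iff.1 hv i
  | right i => simpa using measurable_pi_iff.1 hv' i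

theorem cons {s : α → S} (hs : Measurable s) (hu : MeasurableListMap u) :
    MeasurableListMap fun a ↦ s a :: u a :=
  append (u := fun a ↦ [s a]) ⟨1, fun a _ ↦ s a, by fun_prop, fun _ ↦ by simp⟩ hu

theorem comp (hu : MeasurableListMap u) {g : β → α} (hg : Measurable g) :
    MeasurableListMap fun b ↦ u (g b) := by
  obtain ⟨n, v, hv, h⟩ := hu
  exact ⟨n, fun b ↦ v (g b), hv.comp hg, fun b ↦ h _⟩

theorem measurable_comp {f : List S → β}
    (hf : ∀ n : ℕ, Measurable fun x : Fin n → S ↦ f (List.ofFn x)) (hu : MeasurableListMap u) :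
    Measurable fun a ↦ f (u a) := by
  obtain ⟨n, v, hv, h⟩ := hu
  simp only [h]
  exact (hf n).comp hv

end MeasurableListMap

namespace FlowTask

variable {S A : Type*} [MeasurableSpace S] [MeasurableSpace A]

section SeqIntegral

variable (M : FlowTask S A)

theorem seqIntegral_eq_nil {f : List S → ℝ≥0∞} (hf : ∀ q, q ≠ [] → f q = 0) :
    M.seqIntegral f = f [] := by
  rw [seqIntegral, tsum_eq_single 0]
  · simp
  · intro n hn
    rw [lintegral_congr fun x ↦ hf _ (by simpa using hn), lintegral_zero]

theorem exists_ne_zero_of_seqIntegral_ne_zero {f : List S → ℝ≥0∞} (h : M.seqIntegral f ≠ 0) :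
    ∃ p, f p ≠ 0 := by
  by_contra! hf
  exact h (by simp [seqIntegral, hf])

theorem seqIntegral_mul_const {c : ℝ≥0∞} {f : List S → ℝ≥0∞}
    (hf : ∀ n : ℕ, Measurable fun x : Fin n → S ↦ f (List.ofFn x)) :
    (M.seqIntegral fun p ↦ f p * c) = M.seqIntegral f * c := by
  simp only [seqIntegral, ← ENNReal.tsum_mul_right]
  exact tsum_congr fun n ↦ lintegral_mul_const _ (hf n)

variable [SigmaFinite M.ds]

theorem measurable_seqIntegral {α : Type*} [MeasurableSpace α] {f : α → List S → ℝ≥0∞}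
    (hf : ∀ n, Measurable fun z : α × (Fin n → S) ↦ f z.1 (List.ofFn z.2)) :
    Measurable fun a ↦ M.seqIntegral (f a) :=
  Measurable.tsum fun n ↦ (hf n).lintegral_prod_right'

theorem lintegral_seqIntegral_comm {f : S → List S → ℝ≥0∞}
    (hf : ∀ n : ℕ, Measurable fun z : S × (Fin n → S) ↦ f z.1 (List.ofFn z.2)) :
    ∫⁻ s, M.seqIntegral (f s) ∂M.ds = M.seqIntegral fun p ↦ ∫⁻ s, f s p ∂M.ds := by
  simp only [seqIntegral]
  rw [lintegral_tsum fun n ↦ (hf n).lintegral_prod_right'.aemeasurable]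
  exact tsum_congr fun n ↦ lintegral_lintegral_swap (hf n).aemeasurable

theorem seqIntegral_cons {f : List S → ℝ≥0∞}
    (hf : ∀ n : ℕ, Measurable fun x : Fin n → S ↦ f (List.ofFn x)) :
    M.seqIntegral f = f [] + ∫⁻ s, M.seqIntegral (fun q ↦ f (s :: q)) ∂M.ds := by
  have hcons (n : ℕ) : Measurable fun z : S × (Fin n → S) ↦ f (z.1 :: List.ofFn z.2) :=
    MeasurableListMap.measurable_comp hf (.cons measurable_fst (.ofFn measurable_snd))
  simp only [seqIntegral]
  rw [tsum_eq_zero_add' ENNReal.summable,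
    lintegral_tsum fun n ↦ (hcons n).lintegral_prod_right'.aemeasurable]
  congr 1
  · simp
  · refine tsum_congr fun n ↦ (lintegral_pi_cons M.ds (hf (n + 1))).trans ?_
    simp only [List.ofFn_cons]

theorem seqIntegral_snoc {f : List S → ℝ≥0∞}
    (hf : ∀ n : ℕ, Measurable fun x : Fin n → S ↦ f (List.ofFn x)) :
    M.seqIntegral f = f [] + ∫⁻ s, M.seqIntegral (fun p ↦ f (p ++ [s])) ∂M.ds := by
  have hsnoc (n : ℕ) : Measurable fun z : S × (Fin n → S) ↦ f (List.ofFn z.2 ++ [z.1]) :=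
    MeasurableListMap.measurable_comp hf
      (.append (.ofFn measurable_snd) (.cons measurable_fst (.const [])))
  rw [M.lintegral_seqIntegral_comm hsnoc, seqIntegral, tsum_eq_zero_add' ENNReal.summable]
  congr 1
  · simp
  · refine tsum_congr fun n ↦ (lintegral_pi_snoc M.ds (hf (n + 1))).trans ?_
    simp only [ofFn_finSnoc]

end SeqIntegral

variable {M : FlowTask S A}

theorem IsComplete.isInitial_of_append {p q : List S} (h : M.IsComplete (p ++ q)) (hp : p ≠ []) :
    M.IsInitial p :=
  ⟨(List.isChain_append.1 h.1).1, by simpa [List.head?_append_of_ne_nil _ hp] using h.2.1⟩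

namespace TrajectoryFlow

section Flows

variable (F : M.TrajectoryFlow)

theorem isComplete_of_ne_zero {τ : List S} (h : F.toFun τ ≠ 0) : M.IsComplete τ :=
  not_imp_comm.1 (F.eq_zero τ) h

theorem stateFlow_eq_seqIntegral_prefixFlow (s : S) :
    F.stateFlow s = M.seqIntegral fun p ↦ F.prefixFlow (p ++ [s]) := by
  simp [stateFlow, prefixFlow]

theorem edgeFlow_eq_seqIntegral_prefixFlow (s s' : S) :
    F.edgeFlow s s' = M.seqIntegral fun p ↦ F.prefixFlow (p ++ [s, s']) := by
  simp [edgeFlow, prefixFlow]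

theorem isInitial_of_prefixFlow_ne_zero {p : List S} (h : F.prefixFlow p ≠ 0) (hp : p ≠ []) :
    M.IsInitial p := by
  obtain ⟨q, hq⟩ := M.exists_ne_zero_of_seqIntegral_ne_zero h
  exact (F.isComplete_of_ne_zero (by simpa using hq)).isInitial_of_append hp

theorem prefixFlow_eq_zero_of_not_edge (p : List S) {s s' : S} (h : ¬ M.Edge s s') :
    F.prefixFlow (p ++ [s, s']) = 0 := by
  by_contra hne
  exact h (List.isChain_append_cons_cons.1 (F.isInitial_of_prefixFlow_ne_zero hne (by simp)).1).2.1

theorem edgeFlow_eq_zero_of_not_edge {s s' : S} (h : ¬ M.Edge s s') : F.edgeFlow s s' = 0 := by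
  simp [edgeFlow_eq_seqIntegral_prefixFlow, F.prefixFlow_eq_zero_of_not_edge _ h, seqIntegral]

theorem prefixFlow_singleton_of_ne {s : S} (h : s ≠ M.s₀) : F.prefixFlow [s] = 0 := by
  by_contra hne
  exact h (by simpa using (F.isInitial_of_prefixFlow_ne_zero hne (by simp)).2)

theorem prefixFlow_singleton_s₀ (h₀ : ∀ s, ¬ M.Edge s M.s₀) :
    F.prefixFlow [M.s₀] = F.stateFlow M.s₀ := by
  rw [stateFlow_eq_seqIntegral_prefixFlow, seqIntegral_eq_nil, List.nil_append]
  intro p hp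
  obtain ⟨i, s, rfl⟩ := (List.eq_nil_or_concat p).resolve_left hp
  simpa using F.prefixFlow_eq_zero_of_not_edge i (h₀ s)

theorem toFun_append_of_ne_sf (p : List S) {s : S} (h : s ≠ M.sf) : F.toFun (p ++ [s]) = 0 :=
  F.eq_zero _ fun hc ↦ h (by simpa using hc.2.2)

theorem prefixFlow_append_sf (hf : ∀ s, ¬ M.Edge M.sf s) (p : List S) :
    F.prefixFlow (p ++ [M.sf]) = F.toFun (p ++ [M.sf]) := by
  rw [prefixFlow, seqIntegral_eq_nil, List.append_nil]
  intro q hq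
  obtain ⟨s, q, rfl⟩ := List.exists_cons_of_ne_nil hq
  rw [ENNReal.coe_eq_zero, List.append_assoc]
  exact F.eq_zero _ fun hc ↦ hf s (List.isChain_append_cons_cons.1 hc.1).2.1

theorem measurable_prefixFlow [SigmaFinite M.ds] {α : Type*} [MeasurableSpace α]
    {u : α → List S} (hu : MeasurableListMap u) : Measurable fun a ↦ F.prefixFlow (u a) :=
  M.measurable_seqIntegral fun _ ↦ (((hu.comp measurable_fst).append
    (.ofFn measurable_snd)).measurable_comp F.measurable_toFun).coe_nnreal_ennreal

theorem measurable_prefixFlow_append [SigmaFinite M.ds] (p : List S) :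
    Measurable fun s ↦ F.prefixFlow (p ++ [s]) :=
  F.measurable_prefixFlow (.append (.const p) (.cons measurable_id (.const [])))

theorem prefixFlow_eq_add_lintegral [SigmaFinite M.ds] (p : List S) :
    F.prefixFlow p = F.toFun p + ∫⁻ s, F.prefixFlow (p ++ [s]) ∂M.ds := by
  rw [prefixFlow, seqIntegral_cons M fun n ↦ (((MeasurableListMap.const p).append
    (.ofFn measurable_id)).measurable_comp F.measurable_toFun).coe_nnreal_ennreal]
  simp [prefixFlow]

theorem lintegral_prefixFlow_append_le [SigmaFinite M.ds] (p : List S) :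
    ∫⁻ s, F.prefixFlow (p ++ [s]) ∂M.ds ≤ F.prefixFlow p :=
  F.prefixFlow_eq_add_lintegral p ▸ le_add_self

theorem stateFlow_eq_lintegral_edgeFlow_left [SigmaFinite M.ds] {s' : S} (h : s' ≠ M.s₀) :
    F.stateFlow s' = ∫⁻ s, F.edgeFlow s s' ∂M.ds := by
  have hm (n : ℕ) : Measurable fun x : Fin n → S ↦ F.prefixFlow (List.ofFn x ++ [s']) :=
    F.measurable_prefixFlow (.append (.ofFn measurable_id) (.const [s']))
  rw [stateFlow_eq_seqIntegral_prefixFlow,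
    M.seqIntegral_snoc (f := fun p ↦ F.prefixFlow (p ++ [s'])) hm, List.nil_append,
    F.prefixFlow_singleton_of_ne h, zero_add]
  simp only [edgeFlow_eq_seqIntegral_prefixFlow, List.append_assoc, List.cons_append,
    List.nil_append]

theorem stateFlow_eq_lintegral_edgeFlow_right [SigmaFinite M.ds] {s : S} (h : s ≠ M.sf) :
    F.stateFlow s = ∫⁻ s', F.edgeFlow s s' ∂M.ds := by
  simp only [edgeFlow_eq_seqIntegral_prefixFlow]
  rw [stateFlow_eq_seqIntegral_prefixFlow, lintegral_seqIntegral_comm M fun n ↦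
    F.measurable_prefixFlow (.append (.ofFn measurable_snd)
      (.cons measurable_const (.cons measurable_fst (.const []))))]
  congr 1
  funext p
  rw [F.prefixFlow_eq_add_lintegral, F.toFun_append_of_ne_sf p h]
  simp

end Flows

section Uniqueness

variable {F F' : M.TrajectoryFlow}

theorem IsMarkovian.prefixFlow_append_pair (hF : F.IsMarkovian) {p : List S} {s : S}
    (h0 : F.prefixFlow (p ++ [s]) ≠ 0) (h_top : F.prefixFlow (p ++ [s]) ≠ ∞) (s' : S) :
    F.prefixFlow (p ++ [s, s']) =
      F.edgeFlow s s' / F.stateFlow s * F.prefixFlow (p ++ [s]) := by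
  by_cases hE : M.Edge s s'
  · rw [← hF p s s' (F.isInitial_of_prefixFlow_ne_zero h0 (by simp)) hE h0 h_top,
      ENNReal.div_mul_cancel h0 h_top]
  · simp [F.prefixFlow_eq_zero_of_not_edge p hE, F.edgeFlow_eq_zero_of_not_edge hE]

variable [SigmaFinite M.ds]

theorem ae_prefixFlow_append_eq_zero {p : List S} (h : F.prefixFlow p = 0) :
    ∀ᵐ s ∂M.ds, F.prefixFlow (p ++ [s]) = 0 :=
  (lintegral_eq_zero_iff (F.measurable_prefixFlow_append p)).1
    (le_zero_iff.1 (h ▸ F.lintegral_prefixFlow_append_le p))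

theorem ae_prefixFlow_append_ne_top {p : List S} (h : F.prefixFlow p ≠ ∞) :
    ∀ᵐ s ∂M.ds, F.prefixFlow (p ++ [s]) ≠ ∞ :=
  (ae_lt_top (F.measurable_prefixFlow_append p)
    (ne_top_of_le_ne_top h (F.lintegral_prefixFlow_append_le p))).mono fun _ ↦ LT.lt.ne

theorem IsMarkovian.ae_prefixFlow_append_pair_eq (hF : F.IsMarkovian) (hF' : F'.IsMarkovian)
    (hstate : F'.stateFlow = F.stateFlow) (hedge : F'.edgeFlow = F.edgeFlow) {p : List S} {s : S}
    (h : F'.prefixFlow (p ++ [s]) = F.prefixFlow (p ++ [s]))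
    (h_top : F.prefixFlow (p ++ [s]) ≠ ∞) :
    ∀ᵐ s' ∂M.ds, F'.prefixFlow (p ++ [s, s']) = F.prefixFlow (p ++ [s, s']) := by
  by_cases h0 : F.prefixFlow (p ++ [s]) = 0
  · filter_upwards [ae_prefixFlow_append_eq_zero h0, ae_prefixFlow_append_eq_zero (h.trans h0)]
      with s' hs hs'
    simpa using hs'.trans hs.symm
  · refine .of_forall fun s' ↦ ?_
    rw [hF.prefixFlow_append_pair h0 h_top, hF'.prefixFlow_append_pair (h ▸ h0) (h ▸ h_top),
      h, hstate, hedge]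

theorem IsMarkovian.ae_prefixFlow_eq (hF : F.IsMarkovian) (hF' : F'.IsMarkovian)
    (h₀ : ∀ s, ¬ M.Edge s M.s₀) (h_top : F.stateFlow M.s₀ ≠ ∞)
    (hstate : F'.stateFlow = F.stateFlow) (hedge : F'.edgeFlow = F.edgeFlow) (n : ℕ) :
    ∀ᵐ x ∂(Measure.pi fun _ : Fin (n + 1) ↦ M.ds),
      F'.prefixFlow (List.ofFn x) = F.prefixFlow (List.ofFn x) ∧
        F.prefixFlow (List.ofFn x) ≠ ∞ := by
  induction n with
  | zero =>
    refine .of_forall fun x ↦ ?_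
    rw [List.ofFn_succ, List.ofFn_zero]
    by_cases hs : x 0 = M.s₀
    · rw [hs, F.prefixFlow_singleton_s₀ h₀, F'.prefixFlow_singleton_s₀ h₀, hstate]
      exact ⟨rfl, h_top⟩
    · simp [prefixFlow_singleton_of_ne _ hs]
  | succ n ih =>
    have hm (G : M.TrajectoryFlow) : Measurable fun x : Fin (n + 2) → S ↦
        G.prefixFlow (List.ofFn x) := G.measurable_prefixFlow (.ofFn measurable_id)
    refine ae_pi_of_ae_ae_snoc M.ds ((measurableSet_eq_fun (hm F') (hm F)).inter
      (hm F (measurableSet_singleton ∞).compl)) ?_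
    filter_upwards [ih] with y ⟨heq, hfin⟩
    simp only [ofFn_finSnoc]
    rw [List.ofFn_succ', List.concat_eq_append] at heq hfin ⊢
    simpa using (hF.ae_prefixFlow_append_pair_eq hF' hstate hedge heq hfin).and
      (ae_prefixFlow_append_ne_top hfin)

theorem IsMarkovian.ae_toFun_eq (hF : F.IsMarkovian) (hF' : F'.IsMarkovian)
    (h₀ : ∀ s, ¬ M.Edge s M.s₀) (hf : ∀ s, ¬ M.Edge M.sf s) (h_top : F.stateFlow M.s₀ ≠ ∞)
    (hstate : F'.stateFlow = F.stateFlow) (hedge : F'.edgeFlow = F.edgeFlow) (n : ℕ) :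
    ∀ᵐ x ∂(Measure.pi fun _ : Fin n ↦ M.ds), F'.toFun (List.ofFn x) = F.toFun (List.ofFn x) := by
  cases n with
  | zero =>
    have hnil : ¬ M.IsComplete [] := fun h ↦ by simpa using h.2.1
    exact .of_forall fun x ↦ by simp [F.eq_zero _ hnil, F'.eq_zero _ hnil]
  | succ n =>
    filter_upwards [hF.ae_prefixFlow_eq hF' h₀ h_top hstate hedge n] with x ⟨hx, _⟩
    by_cases hc : M.IsComplete (List.ofFn x)
    · obtain ⟨p, hp⟩ := List.getLast?_eq_some_iff.1 hc.2.2
      rw [hp, prefixFlow_append_sf _ hf, prefixFlow_append_sf _ hf] at hx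
      rw [hp]
      exact_mod_cast hx
    · rw [F.eq_zero _ hc, F'.eq_zero _ hc]

end Uniqueness

end TrajectoryFlow

section NetworkFlow

variable {v : S → ℝ≥0} {e : S → S → ℝ≥0}

/-- The probability `e(s → s') / v(s)` of the transition `s → s'` in the random walk driven by state
values `v` and edge values `e`; it is `0` if `v s = 0`. -/
noncomputable def transitionProb (v : S → ℝ≥0) (e : S → S → ℝ≥0) (s s' : S) : ℝ≥0 := e s s' / v s

/-- Conserved state values `v` and edge values `e`: the value of a state is its inflow (except at
`s₀`) and its outflow (except at `sf`). The edge values live on all pairs of states, and next to a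
state of value `0` they are required to vanish everywhere, where conservation alone would only give
almost everywhere. -/
structure IsNetworkFlow (M : FlowTask S A) (v : S → ℝ≥0) (e : S → S → ℝ≥0) : Prop where
  measurable_edge : Measurable (Function.uncurry e)
  eq_zero_of_not_edge : ∀ s s', ¬ M.Edge s s' → e s s' = 0
  eq_zero_of_left : ∀ s s', v s = 0 → e s s' = 0
  eq_zero_of_right : ∀ s s', v s' = 0 → e s s' = 0
  eq_lintegral_in : ∀ s', s' ≠ M.s₀ → (v s' : ℝ≥0∞) = ∫⁻ s, (e s s' : ℝ≥0∞) ∂M.ds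
  eq_lintegral_out : ∀ s, s ≠ M.sf → (v s : ℝ≥0∞) = ∫⁻ s', (e s s' : ℝ≥0∞) ∂M.ds

open Classical in
/-- The weight that the random walk with initial mass `v s₀` and transition probabilities
`transitionProb v e` gives to a sequence of states; it is `0` unless the sequence starts in `s₀`. -/
noncomputable def initialWeight (M : FlowTask S A) (v : S → ℝ≥0) (e : S → S → ℝ≥0)
    (τ : List S) : ℝ≥0 :=
  if τ.head? = some M.s₀ then v M.s₀ * stepProd (transitionProb v e) τ else 0

theorem initialWeight_append_pair (p : List S) (s s' : S) :
    M.initialWeight v e (p ++ [s, s']) =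
      M.initialWeight v e (p ++ [s]) * transitionProb v e s s' := by
  have hhead : (p ++ [s, s']).head? = (p ++ [s]).head? := by cases p <;> rfl
  rw [initialWeight, initialWeight, hhead, stepProd_append_pair, ite_mul, zero_mul, mul_assoc]

namespace IsNetworkFlow

theorem mul_transitionProb (h : M.IsNetworkFlow v e) (s s' : S) :
    v s * transitionProb v e s s' = e s s' :=
  mul_div_cancel_of_imp' (h.eq_zero_of_left s s')

theorem coe_transitionProb (h : M.IsNetworkFlow v e) (s s' : S) :
    (transitionProb v e s s' : ℝ≥0∞) = e s s' / v s := by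
  by_cases hs : v s = 0
  · simp [transitionProb, hs, h.eq_zero_of_left s s' hs]
  · exact ENNReal.coe_div hs

theorem transitionProb_eq_zero_of_not_edge (h : M.IsNetworkFlow v e) (s s' : S)
    (hE : ¬ M.Edge s s') : transitionProb v e s s' = 0 := by
  rw [transitionProb, h.eq_zero_of_not_edge s s' hE, zero_div]

theorem lintegral_transitionProb (h : M.IsNetworkFlow v e) {s : S} (hs : s ≠ M.sf)
    (h0 : v s ≠ 0) : ∫⁻ s', (transitionProb v e s s' : ℝ≥0∞) ∂M.ds = 1 := by
  have h0' : (v s : ℝ≥0∞) ≠ 0 := ENNReal.coe_ne_zero.2 h0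
  simp only [h.coe_transitionProb, div_eq_mul_inv]
  rw [lintegral_mul_const' _ _ (ENNReal.inv_ne_top.2 h0'), ← h.eq_lintegral_out s hs,
    ENNReal.mul_inv_cancel h0' ENNReal.coe_ne_top]

theorem isInitial_of_initialWeight_ne_zero (h : M.IsNetworkFlow v e) {τ : List S}
    (hτ : M.initialWeight v e τ ≠ 0) : M.IsInitial τ := by
  have hhead : τ.head? = some M.s₀ := by
    by_contra hne
    exact hτ (if_neg hne)
  rw [initialWeight, if_pos hhead] at hτ
  exact ⟨isChain_of_stepProd_ne_zero h.transitionProb_eq_zero_of_not_edge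
    (right_ne_zero_of_mul hτ), hhead⟩

theorem initialWeight_append_eq_zero (h : M.IsNetworkFlow v e) (p : List S) {s : S}
    (hs : v s = 0) : M.initialWeight v e (p ++ [s]) = 0 := by
  obtain rfl | ⟨p, r, rfl⟩ := List.eq_nil_or_concat p
  · by_cases hs₀ : s = M.s₀
    · simp [initialWeight, ← hs₀, hs]
    · simp [initialWeight, hs₀]
  · simp [initialWeight_append_pair, transitionProb, h.eq_zero_of_right r s hs]

theorem lintegral_initialWeight (h : M.IsNetworkFlow v e) (p : List S) {s : S} (hs : s ≠ M.sf) :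
    ∫⁻ s', (M.initialWeight v e (p ++ [s, s']) : ℝ≥0∞) ∂M.ds = M.initialWeight v e (p ++ [s]) := by
  simp only [initialWeight_append_pair, ENNReal.coe_mul]
  rw [lintegral_const_mul' _ _ ENNReal.coe_ne_top]
  by_cases h0 : v s = 0
  · simp [h.initialWeight_append_eq_zero p h0]
  · rw [h.lintegral_transitionProb hs h0, mul_one]

variable [SigmaFinite M.ds] [MeasurableSingletonClass S]

theorem measurable_state (h : M.IsNetworkFlow v e) : Measurable v := by
  classical
  have hv : (fun s' ↦ (v s' : ℝ≥0∞)) =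
      fun s' ↦ if s' = M.s₀ then (v M.s₀ : ℝ≥0∞) else ∫⁻ s, (e s s' : ℝ≥0∞) ∂M.ds := by
    funext s'
    split_ifs with hs
    · rw [hs]
    · exact h.eq_lintegral_in s' hs
  have hin : Measurable fun s' ↦ ∫⁻ s, (e s s' : ℝ≥0∞) ∂M.ds :=
    h.measurable_edge.coe_nnreal_ennreal.lintegral_prod_left'
  exact measurable_coe_nnreal_ennreal_iff.1
    (hv ▸ Measurable.ite (measurableSet_singleton M.s₀) measurable_const hin)

theorem measurable_transitionProb (h : M.IsNetworkFlow v e) :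
    Measurable (Function.uncurry (transitionProb v e)) :=
  h.measurable_edge.div (h.measurable_state.comp measurable_fst)

theorem measurable_initialWeight (h : M.IsNetworkFlow v e) (n : ℕ) :
    Measurable fun x : Fin n → S ↦ M.initialWeight v e (List.ofFn x) := by
  cases n with
  | zero => simp [initialWeight]
  | succ n =>
    have hstep (i : Fin n) : Measurable fun x : Fin (n + 1) → S ↦
        transitionProb v e (x i.castSucc) (x i.succ) :=
      h.measurable_transitionProb.comp (by fun_prop : Measurable fun x : Fin (n + 1) → S ↦
        (x i.castSucc, x i.succ))
    simp only [initialWeight, stepProd_ofFn]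
    refine Measurable.ite ?_ ((Finset.measurable_prod _ fun i _ ↦ hstep i).const_mul _)
      measurable_const
    have hhead : MeasurableSet {x : Fin (n + 1) → S | x 0 = M.s₀} :=
      measurable_pi_apply (X := fun _ ↦ S) 0 (measurableSet_singleton M.s₀)
    simpa [List.ofFn_succ] using hhead

open Classical in
/-- The Markovian flow with state values `v` and edge values `e`: the random walk, stopped at
`sf`. -/
noncomputable def markovFlow (h : M.IsNetworkFlow v e) : M.TrajectoryFlow where
  toFun τ := if τ.getLast? = some M.sf then M.initialWeight v e τ else 0
  measurable_toFun n := by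
    cases n with
    | zero => simp
    | succ n =>
      refine Measurable.ite ?_ (h.measurable_initialWeight (n + 1)) measurable_const
      have hlast : MeasurableSet {x : Fin (n + 1) → S | x (Fin.last n) = M.sf} :=
        measurable_pi_apply (X := fun _ ↦ S) (Fin.last n) (measurableSet_singleton M.sf)
      simpa [List.ofFn_succ', -List.ofFn_succ] using hlast
  eq_zero τ hτ := by
    by_contra hne
    obtain ⟨hlast, hweight⟩ := ite_ne_right_iff.1 hne
    obtain ⟨htraj, hhead⟩ := h.isInitial_of_initialWeight_ne_zero hweight
    exact hτ ⟨htraj, hhead, hlast⟩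

theorem prefixFlow_markovFlow (h : M.IsNetworkFlow v e) (hf : ∀ s, ¬ M.Edge M.sf s)
    (hwf : WellFounded (flip M.Edge)) (p : List S) (s : S) :
    h.markovFlow.prefixFlow (p ++ [s]) = M.initialWeight v e (p ++ [s]) := by
  induction s using hwf.induction generalizing p with
  | h s ih =>
  by_cases hs : s = M.sf
  · rw [hs, TrajectoryFlow.prefixFlow_append_sf _ hf]
    simp [markovFlow]
  · rw [TrajectoryFlow.prefixFlow_eq_add_lintegral, TrajectoryFlow.toFun_append_of_ne_sf _ p hs,
      ENNReal.coe_zero, zero_add, ← h.lintegral_initialWeight p hs]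
    refine lintegral_congr fun s' ↦ ?_
    rw [List.append_assoc, List.singleton_append]
    by_cases hE : M.Edge s s'
    · simpa using ih s' hE (p ++ [s])
    · rw [TrajectoryFlow.prefixFlow_eq_zero_of_not_edge _ p hE, initialWeight_append_pair,
        h.transitionProb_eq_zero_of_not_edge s s' hE, mul_zero, ENNReal.coe_zero]

theorem prefixFlow_markovFlow_append_pair (h : M.IsNetworkFlow v e) (hf : ∀ s, ¬ M.Edge M.sf s)
    (hwf : WellFounded (flip M.Edge)) (p : List S) (s s' : S) :
    h.markovFlow.prefixFlow (p ++ [s, s']) =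
      h.markovFlow.prefixFlow (p ++ [s]) * transitionProb v e s s' := by
  have hpair := h.prefixFlow_markovFlow hf hwf (p ++ [s]) s'
  rw [List.append_assoc, List.singleton_append] at hpair
  rw [hpair, h.prefixFlow_markovFlow hf hwf, initialWeight_append_pair, ENNReal.coe_mul]

theorem edgeFlow_markovFlow_eq_mul (h : M.IsNetworkFlow v e) (hf : ∀ s, ¬ M.Edge M.sf s)
    (hwf : WellFounded (flip M.Edge)) (s s' : S) :
    h.markovFlow.edgeFlow s s' = h.markovFlow.stateFlow s * transitionProb v e s s' := by
  rw [TrajectoryFlow.edgeFlow_eq_seqIntegral_prefixFlow,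
    TrajectoryFlow.stateFlow_eq_seqIntegral_prefixFlow]
  simp only [h.prefixFlow_markovFlow_append_pair hf hwf]
  exact M.seqIntegral_mul_const (f := fun p ↦ h.markovFlow.prefixFlow (p ++ [s])) fun n ↦
    TrajectoryFlow.measurable_prefixFlow _ (.append (.ofFn measurable_id) (.const [s]))

theorem stateFlow_markovFlow (h : M.IsNetworkFlow v e) (h₀ : ∀ s, ¬ M.Edge s M.s₀)
    (hf : ∀ s, ¬ M.Edge M.sf s) (hwf : WellFounded M.Edge) (hwf' : WellFounded (flip M.Edge))
    (s : S) : h.markovFlow.stateFlow s = v s := by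
  induction s using hwf.induction with
  | h s ih =>
  by_cases hs : s = M.s₀
  · rw [hs, ← TrajectoryFlow.prefixFlow_singleton_s₀ _ h₀, ← List.nil_append [M.s₀],
      h.prefixFlow_markovFlow hf hwf']
    simp [initialWeight, stepProd]
  · rw [TrajectoryFlow.stateFlow_eq_lintegral_edgeFlow_left _ hs, h.eq_lintegral_in s hs]
    refine lintegral_congr fun r ↦ ?_
    by_cases hE : M.Edge r s
    · rw [h.edgeFlow_markovFlow_eq_mul hf hwf', ih r hE, ← ENNReal.coe_mul, h.mul_transitionProb]
    · rw [TrajectoryFlow.edgeFlow_eq_zero_of_not_edge _ hE, h.eq_zero_of_not_edge r s hE,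
        ENNReal.coe_zero]

theorem edgeFlow_markovFlow (h : M.IsNetworkFlow v e) (h₀ : ∀ s, ¬ M.Edge s M.s₀)
    (hf : ∀ s, ¬ M.Edge M.sf s) (hwf : WellFounded M.Edge) (hwf' : WellFounded (flip M.Edge))
    (s s' : S) : h.markovFlow.edgeFlow s s' = e s s' := by
  rw [h.edgeFlow_markovFlow_eq_mul hf hwf', h.stateFlow_markovFlow h₀ hf hwf hwf',
    ← ENNReal.coe_mul, h.mul_transitionProb]

theorem isMarkovian_markovFlow (h : M.IsNetworkFlow v e) (h₀ : ∀ s, ¬ M.Edge s M.s₀)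
    (hf : ∀ s, ¬ M.Edge M.sf s) (hwf : WellFounded M.Edge) (hwf' : WellFounded (flip M.Edge)) :
    h.markovFlow.IsMarkovian := by
  intro p s s' _ _ h0 h_top
  rw [h.prefixFlow_markovFlow_append_pair hf hwf', mul_comm, ENNReal.mul_div_cancel_right h0 h_top,
    h.edgeFlow_markovFlow h₀ hf hwf hwf', h.stateFlow_markovFlow h₀ hf hwf hwf',
    h.coe_transitionProb]

theorem markovFlow_ofFn (h : M.IsNetworkFlow v e) {n : ℕ} {τ : Fin (n + 2) → S}
    (hτ : M.IsComplete (List.ofFn τ)) :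
    h.markovFlow.toFun (List.ofFn τ) =
      (∏ i : Fin (n + 1), e (τ i.castSucc) (τ i.succ)) / ∏ i : Fin n, v (τ i.succ.castSucc) := by
  have hs₀ : τ 0 = M.s₀ := by simpa [List.ofFn_succ] using hτ.2.1
  simp only [markovFlow, initialWeight, if_pos hτ.2.1, if_pos hτ.2.2, stepProd_ofFn,
    transitionProb, Finset.prod_div_distrib]
  rw [Fin.prod_univ_succ fun i : Fin (n + 1) ↦ v (τ i.castSucc), Fin.castSucc_zero, hs₀]
  by_cases h0 : v M.s₀ = 0
  · have hprod : ∏ i : Fin (n + 1), e (τ i.castSucc) (τ i.succ) = 0 :=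
      Finset.prod_eq_zero (Finset.mem_univ 0) (h.eq_zero_of_left _ _ (by simpa [hs₀] using h0))
    simp [hprod]
  · rw [← mul_div_assoc, mul_div_mul_left _ _ h0]

end IsNetworkFlow

end NetworkFlow

section EdgeValue

variable [Nonempty A] {Fs : S → ℝ≥0} {Fa : S → A → ℝ≥0}

open Classical in
/-- `F̂(s → s')`, extended by zero to all pairs of states, so that integrals over parents and
children become integrals over all states. -/
noncomputable def edgeValue (M : FlowTask S A) (Fa : S → A → ℝ≥0) (s s' : S) : ℝ≥0 :=
  if M.Edge s s' then M.onEdge Fa s s' else 0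

theorem edgeValue_of_edge {s s' : S} (h : M.Edge s s') : M.edgeValue Fa s s' = M.onEdge Fa s s' :=
  if_pos h

theorem edgeValue_of_not_edge {s s' : S} (h : ¬ M.Edge s s') : M.edgeValue Fa s s' = 0 :=
  if_neg h

theorem action_mem_acts {s s' : S} (h : M.Edge s s') : M.action s s' ∈ M.acts s :=
  Function.invFunOn_mem h

theorem matches_iff {F : M.TrajectoryFlow} :
    M.Matches Fs Fa F ↔ F.stateFlow = (fun s ↦ (Fs s : ℝ≥0∞)) ∧
      F.edgeFlow = fun s s' ↦ (M.edgeValue Fa s s' : ℝ≥0∞) := by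
  refine and_congr funext_iff.symm ⟨fun h ↦ ?_, fun h s s' hE ↦ ?_⟩
  · funext s s'
    by_cases hE : M.Edge s s'
    · rw [h s s' hE, edgeValue_of_edge hE]
    · rw [F.edgeFlow_eq_zero_of_not_edge hE, edgeValue_of_not_edge hE, ENNReal.coe_zero]
  · simp only [h, edgeValue_of_edge hE]

theorem setLIntegral_parents_onEdge {s' : S} (h : MeasurableSet (M.parents s')) :
    ∫⁻ s in M.parents s', (M.onEdge Fa s s' : ℝ≥0∞) ∂M.ds =
      ∫⁻ s, (M.edgeValue Fa s s' : ℝ≥0∞) ∂M.ds := by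
  rw [← lintegral_indicator h]
  refine lintegral_congr fun s ↦ ?_
  by_cases hE : M.Edge s s' <;> simp [parents, edgeValue, hE]

theorem setLIntegral_children_onEdge {s : S} (h : MeasurableSet (M.children s)) :
    ∫⁻ s' in M.children s, (M.onEdge Fa s s' : ℝ≥0∞) ∂M.ds =
      ∫⁻ s', (M.edgeValue Fa s s' : ℝ≥0∞) ∂M.ds := by
  rw [← lintegral_indicator h]
  refine lintegral_congr fun s' ↦ ?_
  by_cases hE : M.Edge s s' <;> simp [children, edgeValue, hE]

end EdgeValue

namespace IsAcyclicTask

variable [MetricSpace S] [MetricSpace A] [Nonempty A]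

theorem reflTransGen_s₀ (hM : M.IsAcyclicTask) (s : S) : Relation.ReflTransGen M.Edge M.s₀ s :=
  Relation.reflTransGen_iff_eq_or_transGen.2 ((em _).imp_right (hM.s₀_before s))

theorem reflTransGen_sf (hM : M.IsAcyclicTask) (s : S) : Relation.ReflTransGen M.Edge s M.sf :=
  Relation.reflTransGen_iff_eq_or_transGen.2
    ((em _).imp Eq.symm fun h ↦ hM.before_sf s h)

theorem exists_isTrajectory_length_le (hM : M.IsAcyclicTask) :
    ∃ N : ℕ, ∀ τ, M.IsTrajectory τ → τ.length ≤ N := by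
  obtain ⟨N, hN⟩ := hM.horizon
  refine ⟨N, fun τ hτ ↦ ?_⟩
  obtain rfl | ⟨i, s, rfl⟩ := List.eq_nil_or_concat τ
  · simp
  · obtain ⟨q, hq, hlast⟩ :=
      exists_isChain_append_of_reflTransGen hτ (by simp) (hM.reflTransGen_sf s)
    obtain ⟨p, hp, hhead⟩ := exists_isChain_prepend_of_reflTransGen hq
      (List.head?_eq_some_head (by simp)) (hM.reflTransGen_s₀ _)
    have hlen := hN _ ⟨hp, hhead, by simpa [List.getLast?_append, hlast] using hlast⟩
    simp only [List.length_append] at hlen ⊢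
    lia

theorem wellFounded_edge (hM : M.IsAcyclicTask) : WellFounded M.Edge :=
  let ⟨_, hN⟩ := hM.exists_isTrajectory_length_le
  wellFounded_of_isChain_length_le hN

theorem wellFounded_flip_edge (hM : M.IsAcyclicTask) : WellFounded (flip M.Edge) :=
  let ⟨_, hN⟩ := hM.exists_isTrajectory_length_le
  wellFounded_of_isChain_length_le fun l hl ↦
    List.length_reverse (as := l) ▸ hN l.reverse (List.isChain_reverse.2 hl)

theorem not_before_self (hM : M.IsAcyclicTask) (s : S) : ¬ M.Before s s :=
  fun h ↦ hM.wellFounded_edge.transGen.irrefl.irrefl s h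

theorem before_s₀_iff (hM : M.IsAcyclicTask) {s : S} : M.Before M.s₀ s ↔ s ≠ M.s₀ :=
  ⟨fun h hs ↦ hM.not_before_self _ (hs ▸ h), hM.s₀_before s⟩

theorem before_sf_iff (hM : M.IsAcyclicTask) {s : S} : M.Before s M.sf ↔ s ≠ M.sf :=
  ⟨fun h hs ↦ hM.not_before_self _ (hs ▸ h), hM.before_sf s⟩

theorem not_edge_s₀ (hM : M.IsAcyclicTask) (s : S) : ¬ M.Edge s M.s₀ :=
  fun h ↦ hM.not_before_self s (.head' h (hM.reflTransGen_s₀ s))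

theorem not_edge_sf (hM : M.IsAcyclicTask) (s : S) : ¬ M.Edge M.sf s :=
  fun h ↦ hM.not_before_self _ (.head' h (hM.reflTransGen_sf s))

theorem measurableSet_children (hM : M.IsAcyclicTask) (s : S) : MeasurableSet (M.children s) :=
  measurable_prodMk_left (x := s) hM.measurableSet_edges

theorem measurableSet_parents (hM : M.IsAcyclicTask) (s : S) : MeasurableSet (M.parents s) :=
  measurable_prodMk_right (y := s) hM.measurableSet_edges

variable {Fs : S → ℝ≥0} {Fa : S → A → ℝ≥0}

theorem matches_markovFlow [SigmaFinite M.ds] [MeasurableSingletonClass S]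
    (hM : M.IsAcyclicTask) (h : M.IsNetworkFlow Fs (M.edgeValue Fa)) :
    M.Matches Fs Fa h.markovFlow :=
  matches_iff.2 ⟨funext (h.stateFlow_markovFlow hM.not_edge_s₀ hM.not_edge_sf hM.wellFounded_edge
    hM.wellFounded_flip_edge), funext₂ (h.edgeFlow_markovFlow hM.not_edge_s₀ hM.not_edge_sf
      hM.wellFounded_edge hM.wellFounded_flip_edge)⟩

theorem ae_toFun_eq_of_matches (hM : M.IsAcyclicTask) {F F' : M.TrajectoryFlow}
    (hF : M.Matches Fs Fa F) (hF' : M.Matches Fs Fa F') (hmarkov : F.IsMarkovian)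
    (hmarkov' : F'.IsMarkovian) (n : ℕ) :
    ∀ᵐ τ ∂(Measure.pi fun _ : Fin n ↦ M.ds), F'.toFun (List.ofFn τ) = F.toFun (List.ofFn τ) := by
  have := hM.sigmaFinite
  obtain ⟨hstate, hedge⟩ := matches_iff.1 hF
  obtain ⟨hstate', hedge'⟩ := matches_iff.1 hF'
  exact hmarkov.ae_toFun_eq hmarkov' hM.not_edge_s₀ hM.not_edge_sf (by simp [hstate])
    (hstate'.trans hstate.symm) (hedge'.trans hedge.symm) n

theorem edgeValue_eq_zero_of_left [OpensMeasurableSpace A] (hM : M.IsAcyclicTask)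
    (hFa : ∀ s, ContinuousOn (Fa s) (M.acts s)) (hF : M.FlowMatching Fs Fa) (s s' : S)
    (hs : Fs s = 0) : M.edgeValue Fa s s' = 0 := by
  by_cases hE : M.Edge s s'
  · have hsf : s ≠ M.sf := fun h ↦ hM.not_edge_sf s' (h ▸ hE)
    have hint : ∫⁻ a in M.acts s, (Fa s a : ℝ≥0∞) ∂M.da = 0 := by
      rw [← (hF.2 s (hM.before_sf s hsf)).2, hs, ENNReal.coe_zero]
    rw [edgeValue_of_edge hE, onEdge]
    exact ENNReal.coe_eq_zero.1 (eqOn_zero_of_setLIntegral_eq_zero (hM.measurableSet_acts s)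
      (ENNReal.continuous_coe.comp_continuousOn (hFa s)) (hM.da_pos s) hint (action_mem_acts hE))
  · exact edgeValue_of_not_edge hE

variable (hFa : ContinuousOn (Function.uncurry Fa) {z : S × A | z.2 ∈ M.acts z.1})
include hFa

theorem continuousOn_onEdge (hM : M.IsAcyclicTask) :
    ContinuousOn (Function.uncurry (M.onEdge Fa)) {z : S × S | M.Edge z.1 z.2} :=
  hFa.comp (continuousOn_fst.prodMk hM.continuousOn_action) fun _ ↦ action_mem_acts

variable [OpensMeasurableSpace S]

theorem edgeValue_eq_zero_of_right (hM : M.IsAcyclicTask) (hF : M.FlowMatching Fs Fa) (s s' : S)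
    (hs : Fs s' = 0) : M.edgeValue Fa s s' = 0 := by
  by_cases hE : M.Edge s s'
  · have hs₀ : s' ≠ M.s₀ := fun h ↦ hM.not_edge_s₀ s (h ▸ hE)
    have hint : ∫⁻ r in M.parents s', (M.onEdge Fa r s' : ℝ≥0∞) ∂M.ds = 0 := by
      rw [← hF.1 s' (hM.s₀_before s' hs₀), hs, ENNReal.coe_zero]
    have hcont : ContinuousOn (fun r ↦ M.onEdge Fa r s') (M.parents s') :=
      (hM.continuousOn_onEdge hFa).comp (f := fun r ↦ (r, s')) (by fun_prop) fun _ h ↦ h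
    rw [edgeValue_of_edge hE]
    exact ENNReal.coe_eq_zero.1 (eqOn_zero_of_setLIntegral_eq_zero (hM.measurableSet_parents s')
      (ENNReal.continuous_coe.comp_continuousOn hcont) (hM.ds_pos s') hint hE)
  · exact edgeValue_of_not_edge hE

variable [SecondCountableTopology S]

theorem measurable_edgeValue (hM : M.IsAcyclicTask) :
    Measurable (Function.uncurry (M.edgeValue Fa)) := by
  classical
  exact (hM.continuousOn_onEdge hFa).measurable_piecewise continuousOn_const hM.measurableSet_edges

theorem setLIntegral_acts_eq (hM : M.IsAcyclicTask) (s : S) :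
    ∫⁻ a in M.acts s, (Fa s a : ℝ≥0∞) ∂M.da =
      ∫⁻ s' in M.children s, (M.onEdge Fa s s' : ℝ≥0∞) ∂M.ds := by
  have hm : Measurable fun s' ↦ (M.edgeValue Fa s s' : ℝ≥0∞) :=
    ((hM.measurable_edgeValue hFa).comp measurable_prodMk_left).coe_nnreal_ennreal
  calc ∫⁻ a in M.acts s, (Fa s a : ℝ≥0∞) ∂M.da
      = ∫⁻ a in M.acts s, (M.edgeValue Fa s (M.T s a) : ℝ≥0∞) ∂M.da :=
        setLIntegral_congr_fun (hM.measurableSet_acts s) fun a ha ↦ by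
          rw [edgeValue_of_edge ⟨a, ha, rfl⟩, onEdge, action,
            (hM.unique_action s).leftInvOn_invFunOn ha]
    _ = ∫⁻ s' in M.children s, (M.edgeValue Fa s s' : ℝ≥0∞) ∂M.ds :=
        (hM.translation s).lintegral_comp hm
    _ = ∫⁻ s' in M.children s, (M.onEdge Fa s s' : ℝ≥0∞) ∂M.ds :=
        setLIntegral_congr_fun (hM.measurableSet_children s) fun s' hE ↦ by
          rw [edgeValue_of_edge hE]

theorem flowMatching_iff (hM : M.IsAcyclicTask) :
    M.FlowMatching Fs Fa ↔
      (∀ s', s' ≠ M.s₀ → (Fs s' : ℝ≥0∞) = ∫⁻ s, (M.edgeValue Fa s s' : ℝ≥0∞) ∂M.ds) ∧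
      ∀ s, s ≠ M.sf → (Fs s : ℝ≥0∞) = ∫⁻ s', (M.edgeValue Fa s s' : ℝ≥0∞) ∂M.ds := by
  simp only [FlowMatching, hM.before_s₀_iff, hM.before_sf_iff, hM.setLIntegral_acts_eq hFa,
    and_self, setLIntegral_parents_onEdge (hM.measurableSet_parents _),
    setLIntegral_children_onEdge (hM.measurableSet_children _)]

theorem flowMatching_of_matches (hM : M.IsAcyclicTask) {F : M.TrajectoryFlow}
    (hF : M.Matches Fs Fa F) : M.FlowMatching Fs Fa := by
  have := hM.sigmaFinite
  obtain ⟨hstate, hedge⟩ := matches_iff.1 hF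
  refine (hM.flowMatching_iff hFa).2 ⟨fun s' hs' ↦ ?_, fun s hs ↦ ?_⟩
  · simpa only [hstate, hedge] using F.stateFlow_eq_lintegral_edgeFlow_left hs'
  · simpa only [hstate, hedge] using F.stateFlow_eq_lintegral_edgeFlow_right hs

theorem isNetworkFlow_edgeValue [OpensMeasurableSpace A] (hM : M.IsAcyclicTask)
    (hF : M.FlowMatching Fs Fa) : M.IsNetworkFlow Fs (M.edgeValue Fa) where
  measurable_edge := hM.measurable_edgeValue hFa
  eq_zero_of_not_edge _ _ := edgeValue_of_not_edge
  eq_zero_of_left := hM.edgeValue_eq_zero_of_left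
    (fun s ↦ hFa.comp (f := fun a ↦ (s, a)) (by fun_prop) fun _ h ↦ h) hF
  eq_zero_of_right := hM.edgeValue_eq_zero_of_right hFa hF
  eq_lintegral_in := ((hM.flowMatching_iff hFa).1 hF).1
  eq_lintegral_out := ((hM.flowMatching_iff hFa).1 hF).2

end IsAcyclicTask

end FlowTask

theorem theorem1_general {S A : Type*}
    [MetricSpace S] [SecondCountableTopology S] [MeasurableSpace S] [OpensMeasurableSpace S]
    [MetricSpace A] [MeasurableSpace A] [OpensMeasurableSpace A] [Nonempty A]
    (M : FlowTask S A) (hM : M.IsAcyclicTask) (Fs : S → ℝ≥0) (Fa : S → A → ℝ≥0)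
    (hFa : ContinuousOn (Function.uncurry Fa) {z : S × A | z.2 ∈ M.acts z.1}) :
    ((∃ F : M.TrajectoryFlow, M.Matches Fs Fa F) ↔ M.FlowMatching Fs Fa) ∧
    (M.FlowMatching Fs Fa →
      ∃ F : M.TrajectoryFlow, M.Matches Fs Fa F ∧ F.IsMarkovian ∧
        (∀ (n : ℕ) (τ : Fin (n + 2) → S), M.IsComplete (List.ofFn τ) →
          F.toFun (List.ofFn τ) =
            (∏ i : Fin (n + 1), M.onEdge Fa (τ i.castSucc) (τ i.succ)) /
              ∏ i : Fin n, Fs (τ i.succ.castSucc)) ∧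
        ∀ F' : M.TrajectoryFlow, M.Matches Fs Fa F' → F'.IsMarkovian →
          ∀ n : ℕ, ∀ᵐ τ ∂(Measure.pi fun _ : Fin n ↦ M.ds),
            F'.toFun (List.ofFn τ) = F.toFun (List.ofFn τ)) := by
  have := hM.sigmaFinite
  suffices hex : M.FlowMatching Fs Fa → _ from
    ⟨⟨fun ⟨_, hF⟩ ↦ hM.flowMatching_of_matches hFa hF, fun hF ↦ (hex hF).imp fun _ h ↦ h.1⟩, hex⟩
  intro hF
  have h := hM.isNetworkFlow_edgeValue hFa hF
  have hmatch := hM.matches_markovFlow h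
  have hmarkov := h.isMarkovian_markovFlow hM.not_edge_s₀ hM.not_edge_sf hM.wellFounded_edge
    hM.wellFounded_flip_edge
  refine ⟨h.markovFlow, hmatch, hmarkov, fun n τ hτ ↦ ?_, fun F' hF' hmarkov' ↦
    hM.ae_toFun_eq_of_matches hmatch hF' hmarkov hmarkov'⟩
  have hedge (i : Fin (n + 1)) : M.Edge (τ i.castSucc) (τ i.succ) :=
    List.isChain_ofFn.1 hτ.1 i (by lia)
  simp only [h.markovFlow_ofFn hτ, FlowTask.edgeValue_of_edge (hedge _)]

theorem theorem1 {S A : Type*}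
    [MetricSpace S] [SecondCountableTopology S] [MeasurableSpace S] [BorelSpace S]
    [MetricSpace A] [SecondCountableTopology A] [MeasurableSpace A] [BorelSpace A] [Nonempty A]
    (M : FlowTask S A) (hM : M.IsAcyclicTask)
    (Fs : S → ℝ≥0) (Fa : S → A → ℝ≥0) (L : ℝ≥0)
    (hLa : ∀ s, LipschitzWith L fun a ↦ Fa s a)
    (hLs : ∀ a, LipschitzWith L fun s ↦ Fa s a) :
    ((∃ F : M.TrajectoryFlow, M.Matches Fs Fa F) ↔ M.FlowMatching Fs Fa) ∧
    (M.FlowMatching Fs Fa →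
      ∃ F : M.TrajectoryFlow, M.Matches Fs Fa F ∧ F.IsMarkovian ∧
        (∀ (n : ℕ) (τ : Fin (n + 2) → S), M.IsComplete (List.ofFn τ) →
          F.toFun (List.ofFn τ) =
            (∏ i : Fin (n + 1), M.onEdge Fa (τ i.castSucc) (τ i.succ)) /
              ∏ i : Fin n, Fs (τ i.succ.castSucc)) ∧
        ∀ F' : M.TrajectoryFlow, M.Matches Fs Fa F' → F'.IsMarkovian →
          ∀ n : ℕ, ∀ᵐ τ ∂(Measure.pi fun _ : Fin n ↦ M.ds),
            F'.toFun (List.ofFn τ) = F.toFun (List.ofFn τ)) :=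
  theorem1_general M hM Fs Fa (continuous_prod_of_continuous_lipschitzWith (Function.uncurry Fa) L
    (fun s ↦ (hLa s).continuous) hLs).continuousOn
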